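/- Let $F(t)$, $t=(t^1,\dots,t^n)\in U$ with $U\subseteq\mathbb C^n$ open, be a holomorphic solution of the WDVV equations of associativity: there are a constant symmetric nondegenerate matrix $(\eta_{\alpha\beta})$ with inverse $(\eta^{\alpha\beta})$ and constants $q_\alpha,r_\alpha,d$, $A_{\alpha\beta}=A_{\beta\alpha},B_\alpha,C$ such that (summing over repeated indices) $$\partial_\alpha\partial_\beta\partial_\lambda F\,\eta^{\lambda\mu}\,\partial_\mu\partial_\gamma\partial_\delta F=\partial_\delta\partial_\beta\partial_\lambda F\,\eta^{\lambda\mu}\,\partial_\mu\partial_\gamma\partial_\alpha F,\qquad \partial_1\partial_\alpha\partial_\beta F=\eta_{\alpha\beta},$$ $$E^\alpha\partial_\alpha F=(3-d)F+\tfrac12A_{\alpha\beta}t^\alpha t^\beta+B_\alpha t^\alpha+C,\qquad E^\alpha=(1-q_\alpha)t^\alpha+r_\alpha,$$ with the normalizations $q_1=0$; $r_\alpha\neq0$ only if $q_\alpha=1$; $A_{\alpha\beta}\ne0$ only if $q_\alpha+q_\beta=d-1$; $B_\alpha\neq0$ only if $q_\alpha=d-2$; $C\neq0$ only if $d=3$;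 $A_{1\alpha}=\sum_\varepsilon\eta_{\alpha\varepsilon}r_\varepsilon$; $B_1=0$. Put $c^\gamma_{\alpha\beta}=\eta^{\gamma\varepsilon}\partial_\varepsilon\partial_\alpha\partial_\beta F$, $\partial_\alpha\cdot\partial_\beta=c_{\alpha\beta}^\gamma\partial_\gamma$, $c^{\alpha\beta}_\gamma=\eta^{\alpha\alpha'}\eta^{\beta\beta'}\partial_{\alpha'}\partial_{\beta'}\partial_\gamma F$, $\langle\partial_\alpha,\partial_\beta\rangle=\eta_{\alpha\beta}$, $\mu_\alpha=q_\alpha-\frac d2$, $\mu=\mathrm{diag}(\mu_1,\dots,\mu_n)$. Let $R=(R^\alpha_\beta)$ be a constant matrix with $R^\alpha_\beta\neq0$ only if $\mu_\alpha-\mu_\beta$ is a positive integer, and for $k\ge1$ let $R_k$ consist of the entries of $R$ with $\mu_\alpha-\mu_\beta=k$; suppose $\langle R_ka,b\rangle+(-1)^k\langle a,R_kb\rangle=0$ for all $k\geq 1$ and all vectors $a,b$. Let $\theta_{\alpha,p}(t)$ ($1\le\alpha\le n$, $p\ge0$) be holomorphic functions on $U$ with $$\theta_{\alpha,0}=\eta_{\alpha\varepsilon}t^\varepsilon,\qquad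 \partial_\alpha\partial_\beta\theta_{\gamma,p+1}=c^\rho_{\alpha\beta}\,\partial_\rho\theta_{\gamma,p},$$ such that for every $t\in U$ the series $\nabla\theta_\alpha(t,z)=\sum_p\nabla\theta_{\alpha,p}(t)z^p$ converge for small $|z|$ and satisfy there $\langle\nabla\theta_\alpha(t,z),\nabla\theta_\beta(t,-z)\rangle=\eta_{\alpha\beta}$, and such that the columns $\nabla\tilde t_1,\dots,\nabla\tilde t_n$ of the matrix $Y(t,z)=(\nabla\theta_1(t,z),\dots,\nabla\theta_n(t,z))\,z^\mu z^R$ satisfy $\widetilde\nabla_{d/dz}\,d\tilde t_\alpha=0$ for small $z\neq0$ (off the cut of the principal branch), where $\widetilde\nabla_{d/dz}v=\partial_zv+E\cdot v-\frac1z\mu v$ on vectors. On the space of smooth $L$-periodic loops $v:\mathbb R\to U$ ($L>0$) consider the brackets $$\{v^\alpha(X),v^\beta(Y)\}^{(0)}_1=\eta^{\alpha\beta}\delta'(X-Y),\qquad \{v^\alpha(X),v^\beta(Y)\}^{(0)}_2=g^{\alpha\beta}(v(X))\,\delta'(X-Y)+\Gamma^{\alpha\beta}_\gamma(v(X))\,v^\gamma_X\,\delta(X-Y),$$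 where $g^{\alpha\beta}=E^\varepsilon c^{\alpha\beta}_\varepsilon$ and $\Gamma^{\alpha\beta}_\gamma=\left(\frac{1+d}2-q_\beta\right)c^{\alpha\beta}_\gamma$, and the functionals $H_{\alpha,p}=\int_0^L\theta_{\alpha,p+1}(v(X))\,dX$ for $p\ge-1$. Define $$R_{0,0}=1,\qquad R_{k,0}=0\ (k>0),\qquad R_{k,l}=\sum_{i_1+\dots+i_l=k,\ i_j\ge1}R_{i_1}\cdots R_{i_l}\ (l>0).$$ Then for all $1\le\alpha\le n$ and $p\ge0$ with $p+\mu_\alpha+\frac12\neq0$ the flow $\frac{\partial v}{\partial T^{\alpha,p}}=\{v,H_{\alpha,p}\}^{(0)}_1$ is also Hamiltonian with respect to the second bracket: $$\{v,H_{\alpha,p}\}^{(0)}_1=\{v,\hat H_{\alpha,p}\}^{(0)}_2,\qquad \hat H_{\alpha,p}=\sum_{k\ge0}\ \sum_{l=0}^{p}(-1)^k\,(R_{p-l,k})^\varepsilon_\alpha\,\frac{H_{\varepsilon,l-1}}{(p+\mu_\alpha+\frac12)^{k+1}}$$ at every loop $v$ in $U$, and both functionals have a variational derivative there. (The sum over $k$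 is finite, as $R_{m,k}=0$ for $k>m$.) -/

import Mathlib

open scoped ContDiff

noncomputable section

namespace GenusZero

/-- The partial derivative `∂_α f` of a function on `ℂⁿ`. -/
def pd {n : ℕ} (α : Fin n) (f : (Fin n → ℂ) → ℂ) (t : Fin n → ℂ) : ℂ :=
  fderiv ℂ f t (Pi.single α 1)

/-- A solution of the WDVV equations of associativity on an open set `U ⊆ ℂⁿ`, i.e. a Frobenius
manifold in flat coordinates. The distinguished index `1` of the literature is `0 : Fin n`.
`η` is the matrix with lower indices `η_{αβ}`; the matrix `η^{αβ}` is `η⁻¹`. -/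
structure WDVVSolution (n : ℕ) [NeZero n] where
  /-- the domain of the flat coordinates -/
  U : Set (Fin n → ℂ)
  /-- the potential -/
  F : (Fin n → ℂ) → ℂ
  /-- the constant metric, lower indices -/
  η : Matrix (Fin n) (Fin n) ℂ
  /-- the charges -/
  q : Fin n → ℂ
  /-- the constant part of the Euler vector field -/
  r : Fin n → ℂ
  /-- the dimension -/
  d : ℂ
  /-- quadratic terms in the quasihomogeneity equation -/
  A : Matrix (Fin n) (Fin n) ℂ
  /-- linear terms in the quasihomogeneity equation -/
  B : Fin n → ℂ
  /-- constant term in the quasihomogeneity equation -/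
  C : ℂ
  isOpen_U : IsOpen U
  analytic_F : AnalyticOnNhd ℂ F U
  eta_symm : η.IsSymm
  eta_nondeg : IsUnit η.det
  /-- associativity -/
  wdvv : ∀ t ∈ U, ∀ α β γ δ : Fin n,
    ∑ l, ∑ m, pd α (pd β (pd l F)) t * η⁻¹ l m * pd m (pd γ (pd δ F)) t =
      ∑ l, ∑ m, pd δ (pd β (pd l F)) t * η⁻¹ l m * pd m (pd γ (pd α F)) t
  /-- `∂_1` is the unity and `η` is the metric -/
  unity : ∀ t ∈ U, ∀ α β : Fin n, pd 0 (pd α (pd β F)) t = η α β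
  /-- quasihomogeneity -/
  quasihom : ∀ t ∈ U,
    ∑ α, ((1 - q α) * t α + r α) * pd α F t =
      (3 - d) * F t + (1 / 2) * (∑ α, ∑ β, A α β * t α * t β) + (∑ α, B α * t α) + C
  A_symm : A.IsSymm
  q_one : q 0 = 0
  r_norm : ∀ α, r α ≠ 0 → q α = 1
  A_norm : ∀ α β, A α β ≠ 0 → q α + q β = d - 1
  B_norm : ∀ α, B α ≠ 0 → q α = d - 2
  C_norm : C ≠ 0 → d = 3
  A_one : ∀ α, A 0 α = ∑ ε, η α ε * r ε
  B_one : B 0 = 0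

namespace WDVVSolution

variable {n : ℕ} [NeZero n] (M : WDVVSolution n)

/-- Structure constants with lower indices, `c_{αβγ} = ∂_α ∂_β ∂_γ F`. -/
def cLow (α β γ : Fin n) (t : Fin n → ℂ) : ℂ := pd α (pd β (pd γ M.F)) t

/-- Structure constants `c^γ_{αβ}` of the multiplication, `∂_α · ∂_β = c^γ_{αβ} ∂_γ`. -/
def c (γ α β : Fin n) (t : Fin n → ℂ) : ℂ := ∑ ε, M.η⁻¹ γ ε * M.cLow ε α β t

/-- `c^{αβ}_γ = η^{αα'} η^{ββ'} ∂_{α'} ∂_{β'} ∂_γ F`. -/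
def cUp (α β γ : Fin n) (t : Fin n → ℂ) : ℂ :=
  ∑ a, ∑ b, M.η⁻¹ α a * M.η⁻¹ β b * M.cLow a b γ t

/-- The components of the Euler vector field, `E^ε = (1 - q_ε) t^ε + r_ε`. -/
def euler (t : Fin n → ℂ) (ε : Fin n) : ℂ := (1 - M.q ε) * t ε + M.r ε

/-- The spectrum `μ_α = q_α - d/2`. -/
def mu (α : Fin n) : ℂ := M.q α - M.d / 2

/-- The matrix of multiplication by the Euler vector field. -/
def eulerMul (t : Fin n → ℂ) : Matrix (Fin n) (Fin n) ℂ :=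
  Matrix.of fun γ β => ∑ ε, M.euler t ε * M.c γ ε β t

/-- The intersection form `g^{αβ} = (dt^α, dt^β) = E^ε c_ε^{αβ}`. -/
def g (t : Fin n → ℂ) : Matrix (Fin n) (Fin n) ℂ :=
  Matrix.of fun α β => ∑ ε, M.euler t ε * M.cUp α β ε t

/-- The contravariant Levi-Civita coefficients `Γ^{αβ}_γ = ((1 + d)/2 - q_β) c^{αβ}_γ` of the
intersection form. -/
def Gam (α β γ : Fin n) (t : Fin n → ℂ) : ℂ := ((1 + M.d) / 2 - M.q β) * M.cUp α β γ t

/-- The component `R_k` of a matrix `R`: the entries `R^α_β` with `μ_α - μ_β = k`. -/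
def comp (R : Matrix (Fin n) (Fin n) ℂ) (k : ℕ) : Matrix (Fin n) (Fin n) ℂ := by
  classical
  exact Matrix.of fun α β => if M.mu α - M.mu β = k then R α β else 0

/-- The matrices `R_{k,l}`: `R_{0,0} = 1`, `R_{k,0} = 0` for `k > 0`, and for `l > 0`
`R_{k,l} = ∑ R_{i_1} ⋯ R_{i_l}` over all `i_1, …, i_l ≥ 1` with `i_1 + ⋯ + i_l = k`. -/
def compProd (R : Matrix (Fin n) (Fin n) ℂ) (k : ℕ) : ℕ → Matrix (Fin n) (Fin n) ℂ
  | 0 => if k = 0 then 1 else 0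
  | l + 1 => ∑ i ∈ (Finset.Nat.antidiagonalTuple (l + 1) k).filter (fun i => ∀ j, 1 ≤ i j),
      (List.ofFn fun j => M.comp R (i j)).prod

/-- `R_{k,l}` vanishes for `l > k`, so that sums over all `l` are finite. -/
theorem compProd_eq_zero (R : Matrix (Fin n) (Fin n) ℂ) {k l : ℕ} (h : k < l) :
    M.compProd R k l = 0 := by
  cases l with
  | zero => exact absurd h (Nat.not_lt_zero _)
  | succ l =>
    unfold compProd
    refine Finset.sum_eq_zero fun i hi => ?_
    rw [Finset.mem_filter, Finset.Nat.mem_antidiagonalTuple] at hi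
    have h1 : ∑ _j : Fin (l + 1), 1 ≤ ∑ j, i j := Finset.sum_le_sum fun j _ => hi.2 j
    simp only [Finset.sum_const, Finset.card_univ, Fintype.card_fin, smul_eq_mul, mul_one] at h1
    omega

end WDVVSolution

/-- `z ^ R = exp (R log z)`, principal branch. -/
def zpowMatrix {n : ℕ} (R : Matrix (Fin n) (Fin n) ℂ) (z : ℂ) : Matrix (Fin n) (Fin n) ℂ :=
  NormedSpace.exp (Complex.log z • R)

section DeformedCoordinates

variable {n : ℕ} [NeZero n] (M : WDVVSolution n) (θ : Fin n → ℕ → (Fin n → ℂ) → ℂ)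

/-- The matrix whose `β`-th column is the gradient `(∇ θ_{β,p})^α = η^{αγ} ∂_γ θ_{β,p}`. -/
def gradCoeff (p : ℕ) (t : Fin n → ℂ) : Matrix (Fin n) (Fin n) ℂ :=
  Matrix.of fun α β => ∑ γ, M.η⁻¹ α γ * pd γ (θ β p) t

/-- The matrix `(∇ θ_1(t,z), …, ∇ θ_n(t,z))`, where `∇ θ_β(t,z) = ∑_p ∇ θ_{β,p}(t) z^p`. -/
def gradSeries (t : Fin n → ℂ) (z : ℂ) : Matrix (Fin n) (Fin n) ℂ :=
  Matrix.of fun α β => ∑' p, gradCoeff M θ p t α β * z ^ p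

/-- The matrix `Y(t,z) = (∇ θ_1(t,z), …, ∇ θ_n(t,z)) z^μ z^R`. -/
def fundMatrix (R : Matrix (Fin n) (Fin n) ℂ) (t : Fin n → ℂ) (z : ℂ) :
    Matrix (Fin n) (Fin n) ℂ :=
  gradSeries M θ t z * Matrix.diagonal (fun α => z ^ M.mu α) * zpowMatrix R z

/-- Every column `∇ t̃` of a matrix `Y(z)` of vectors at the point `t` satisfies
`∇̃_{d/dz} d t̃ = 0` at `z`, where `∇̃_{d/dz} v = ∂_z v + E · v - z⁻¹ μ v` on vectors.
The entries of `η Y` are the components of the covectors `d t̃`, and on a covector `ω` the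
equation reads `∂_z ω_α = ω_γ (E · - z⁻¹ μ)^γ_α`. -/
def IsFlatInZ (t : Fin n → ℂ) (Y : ℂ → Matrix (Fin n) (Fin n) ℂ) (z : ℂ) : Prop :=
  ∀ α β : Fin n, HasDerivAt (fun w => (M.η * Y w) α β)
    (((M.eulerMul t - z⁻¹ • Matrix.diagonal M.mu).transpose * (M.η * Y z)) α β) z

/-- The functions `θ_{α,p}` are the coefficients of a system of deformed flat coordinates of the
Frobenius manifold, normalized at `z = 0` with the monodromy matrix `R`. -/
structure IsDeformedFlat (R : Matrix (Fin n) (Fin n) ℂ) : Prop where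
  analytic : ∀ α p, AnalyticOnNhd ℂ (θ α p) M.U
  zero : ∀ α, ∀ t ∈ M.U, θ α 0 t = ∑ ε, M.η α ε * t ε
  /-- flatness along the manifold -/
  recursion : ∀ t ∈ M.U, ∀ α β γ p,
    pd α (pd β (θ γ (p + 1))) t = ∑ ρ, M.c ρ α β t * pd ρ (θ γ p) t
  /-- `R^α_β ≠ 0` only if `μ_α - μ_β` is a positive integer -/
  R_support : ∀ α β, R α β ≠ 0 → ∃ k : ℕ, 0 < k ∧ M.mu α - M.mu β = k
  /-- `⟨R_k a, b⟩ + (-1)^k ⟨a, R_k b⟩ = 0` -/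
  R_skew : ∀ k : ℕ, 0 < k →
    (M.comp R k).transpose * M.η + (-1 : ℂ) ^ k • (M.η * M.comp R k) = 0
  /-- Near `z = 0` the gradient series converge, satisfy
  `⟨∇ θ_α(t,z), ∇ θ_β(t,-z)⟩ = η_{αβ}`, and `Y(t,z)` solves the equation in `z`. -/
  fund : ∀ t ∈ M.U, ∃ ρ : ℝ, 0 < ρ ∧
    (∀ z : ℂ, ‖z‖ < ρ → ∀ α β, Summable fun p => gradCoeff M θ p t α β * z ^ p) ∧
    (∀ z : ℂ, ‖z‖ < ρ →
      (gradSeries M θ t z).transpose * M.η * gradSeries M θ t (-z) = M.η) ∧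
    (∀ z ∈ Complex.slitPlane, ‖z‖ < ρ → IsFlatInZ M t (fundMatrix M θ R t) z)

end DeformedCoordinates

/-- A smooth loop of period `L` in `ℂⁿ`. -/
def IsSmoothLoop {n : ℕ} (L : ℝ) (v : ℝ → Fin n → ℂ) : Prop :=
  ContDiff ℝ ∞ v ∧ Function.Periodic v L

/-- `δ` is the variational derivative of the functional `H` at the loop `v`:
`d/ds H(v + s w) |_{s = 0} = ∫ δ_β(X) w^β(X) dX` for all smooth variations `w`. -/
def HasVarDeriv {n : ℕ} (L : ℝ) (H : (ℝ → Fin n → ℂ) → ℂ) (v δ : ℝ → Fin n → ℂ) : Prop :=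
  IsSmoothLoop L δ ∧ ∀ w : ℝ → Fin n → ℂ, IsSmoothLoop L w →
    HasDerivAt (fun s : ℂ => H fun X => v X + s • w X)
      (∫ X in (0 : ℝ)..L, ∑ β, δ X β * w X β) 0

open Classical in
/-- The variational derivative `δH/δv` of a functional at a loop (`0` if there is none). -/
def varDeriv {n : ℕ} (L : ℝ) (H : (ℝ → Fin n → ℂ) → ℂ) (v : ℝ → Fin n → ℂ) :
    ℝ → Fin n → ℂ :=
  if h : ∃ δ, HasVarDeriv L H v δ then h.choose else 0

/-- The variational derivative is unique. -/
theorem HasVarDeriv.unique {n : ℕ} {L : ℝ} (hL : 0 < L) {H : (ℝ → Fin n → ℂ) → ℂ}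
    {v δ δ' : ℝ → Fin n → ℂ} (h : HasVarDeriv L H v δ) (h' : HasVarDeriv L H v δ') : δ = δ' := by
  have hs : IsSmoothLoop L (fun X β => (starRingEnd ℂ) (δ X β - δ' X β)) := by
    refine ⟨contDiff_pi.2 fun β => ?_, fun X => ?_⟩
    · exact Complex.conjCLE.contDiff.comp
        (((contDiff_pi.1 h.1.1) β).sub ((contDiff_pi.1 h'.1.1) β))
    · funext β
      simp only [h.1.2 X, h'.1.2 X]
  have hcd : ∀ β, Continuous fun X => δ X β := fun β => ((contDiff_pi.1 h.1.1) β).continuous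
  have hcd' : ∀ β, Continuous fun X => δ' X β := fun β => ((contDiff_pi.1 h'.1.1) β).continuous
  have key := (h.2 _ hs).unique (h'.2 _ hs)
  rw [← sub_eq_zero, ← intervalIntegral.integral_sub
    (Continuous.intervalIntegrable (by fun_prop) _ _)
    (Continuous.intervalIntegrable (by fun_prop) _ _)] at key
  have e : ∀ X, (∑ β, δ X β * (starRingEnd ℂ) (δ X β - δ' X β)) -
      (∑ β, δ' X β * (starRingEnd ℂ) (δ X β - δ' X β)) =
      ((∑ β, ‖δ X β - δ' X β‖ ^ 2 : ℝ) : ℂ) := by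
    intro X
    rw [← Finset.sum_sub_distrib]
    push_cast
    refine Finset.sum_congr rfl fun β _ => ?_
    rw [← sub_mul, Complex.mul_conj']
  simp only [e] at key
  rw [intervalIntegral.integral_ofReal, Complex.ofReal_eq_zero] at key
  have hc : Continuous fun X => ∑ β, ‖δ X β - δ' X β‖ ^ 2 := by fun_prop
  have hz : ∀ X ∈ Set.Icc (0 : ℝ) L, ∑ β, ‖δ X β - δ' X β‖ ^ 2 = 0 := by
    by_contra! hne
    obtain ⟨X, hX, hX0⟩ := hne
    have hpos : 0 < ∑ β, ‖δ X β - δ' X β‖ ^ 2 :=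
      lt_of_le_of_ne (Finset.sum_nonneg fun _ _ => by positivity) (Ne.symm hX0)
    exact (intervalIntegral.integral_pos hL hc.continuousOn
      (fun Y _ => Finset.sum_nonneg fun _ _ => by positivity) ⟨X, hX, hpos⟩).ne' key
  have hper : Function.Periodic (fun X => ∑ β, ‖δ X β - δ' X β‖ ^ 2) L := fun X => by
    simp only [h.1.2 X, h'.1.2 X]
  funext X β
  obtain ⟨Y, hY, hXY⟩ := hper.exists_mem_Ico₀ hL X
  have h0 : ∑ β, ‖δ X β - δ' X β‖ ^ 2 = 0 := hXY.trans (hz Y (Set.Ico_subset_Icc_self hY))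
  have h1 := (Finset.sum_eq_zero_iff_of_nonneg (fun _ _ => by positivity)).1 h0 β
    (Finset.mem_univ β)
  exact sub_eq_zero.1 (norm_eq_zero.1 (pow_eq_zero_iff (two_ne_zero)|>.1 h1))

/-- For a Poisson bracket of hydrodynamic type on the loop space,
`{v^α(X), v^β(Y)} = a^{αβ}(v(X)) δ'(X - Y) + b^{αβ}_γ(v(X)) v^γ_X δ(X - Y)`,
the value `{v^α(X), H} = ∫ {v^α(X), v^β(Y)} δH/δv^β(Y) dY
  = a^{αβ}(v) ∂_X (δH/δv^β) + b^{αβ}_γ(v) v^γ_X δH/δv^β` at the loop `v`. -/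
def hydroBracket {n : ℕ} (L : ℝ) (a : (Fin n → ℂ) → Matrix (Fin n) (Fin n) ℂ)
    (b : Fin n → Fin n → Fin n → (Fin n → ℂ) → ℂ)
    (H : (ℝ → Fin n → ℂ) → ℂ) (v : ℝ → Fin n → ℂ) (X : ℝ) (α : Fin n) : ℂ :=
  ∑ β, a (v X) α β * deriv (fun Y => varDeriv L H v Y β) X +
    ∑ β, (∑ γ, b α β γ (v X) * deriv (fun Y => v Y γ) X) * varDeriv L H v X β

section Hierarchy

variable {n : ℕ} [NeZero n] (M : WDVVSolution n)

/-- The first bracket, `{v^α(X), v^β(Y)}_1 = η^{αβ} δ'(X - Y)`; this is `{v^α(X), H}_1`. -/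
def bracket₁ (L : ℝ) (H : (ℝ → Fin n → ℂ) → ℂ) (v : ℝ → Fin n → ℂ) (X : ℝ) (α : Fin n) : ℂ :=
  hydroBracket L (fun _ => M.η⁻¹) (fun _ _ _ _ => 0) H v X α

/-- The second bracket,
`{v^α(X), v^β(Y)}_2 = g^{αβ}(v(X)) δ'(X - Y) + Γ^{αβ}_γ(v(X)) v^γ_X δ(X - Y)`;
this is `{v^α(X), H}_2`. -/
def bracket₂ (L : ℝ) (H : (ℝ → Fin n → ℂ) → ℂ) (v : ℝ → Fin n → ℂ) (X : ℝ) (α : Fin n) : ℂ :=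
  hydroBracket L M.g M.Gam H v X α

/-- `H_{α,l-1} = ∫ θ_{α,l}(v(X)) dX` for `l ≥ 0`. -/
def hamPred (L : ℝ) (θ : Fin n → ℕ → (Fin n → ℂ) → ℂ) (α : Fin n) (l : ℕ)
    (v : ℝ → Fin n → ℂ) : ℂ :=
  ∫ X in (0 : ℝ)..L, θ α l (v X)

/-- The Hamiltonians of the hierarchy, `H_{α,p} = ∫ θ_{α,p+1}(v(X)) dX` for `p ≥ 0`. -/
def ham (L : ℝ) (θ : Fin n → ℕ → (Fin n → ℂ) → ℂ) (α : Fin n) (p : ℕ)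
    (v : ℝ → Fin n → ℂ) : ℂ :=
  hamPred L θ α (p + 1) v

/-- `Ĥ_{α,p} = ∑_{k,l} (-1)^k (R_{p-l,k})^ε_α H_{ε,l-1} / (p + μ_α + 1/2)^{k+1}`, where
`0 ≤ l ≤ p`; the terms with `k > p - l` vanish. -/
def hamHat (L : ℝ) (θ : Fin n → ℕ → (Fin n → ℂ) → ℂ) (R : Matrix (Fin n) (Fin n) ℂ)
    (α : Fin n) (p : ℕ) (v : ℝ → Fin n → ℂ) : ℂ :=
  ∑ k ∈ Finset.range (p + 1), ∑ l ∈ Finset.range (p + 1), ∑ ε,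
    (-1) ^ k * M.compProd R (p - l) k ε α * hamPred L θ ε l v /
      ((p : ℂ) + M.mu α + 1 / 2) ^ (k + 1)

end Hierarchy

end GenusZero

end

noncomputable section

namespace GenusZero
open Filter Topology

/-! ### Power series near `0` -/

/-! Fix `X` and `β`, and write `h_{l,σ} = {v^β, H_{σ,l}}_1` and `b_{l,σ} = {v^β, H_{σ,l-1}}_2`.
Everything rests on the bihamiltonian recursion `b_{l,σ} = (l + 1/2 + μ_σ) h_{l,σ} + ∑_{1 ≤ k ≤ l}
h_{l-k,τ} (R_k)^τ_σ` (`IsDeformedFlat.second_bracket_density`), which is then solved for `h_{p,α}`.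

The recursion has two sources. Cancelling `z^μ z^R` from the equation in `z` and comparing Taylor
coefficients (`IsDeformedFlat.coeff_recursion`) gives `(l + μ_β + μ_σ) ∂_β θ_{σ,l} + ∑_k ∂_β
θ_{τ,l-k} (R_k)^τ_σ = (E ·)^ρ_β ∂_ρ θ_{σ,l-1}`. Flatness along the manifold and associativity
(`g_mul_c`) give `g^{αβ} ∂_γ ∂_β θ_{σ,l} = c^{αβ}_γ (E ·)^ρ_β ∂_ρ θ_{σ,l-1}`. Since `Γ^{αβ}_γ = (1/2
- μ_β) c^{αβ}_γ`, adding the `Γ` term of the second bracket cancels `μ_β` and leaves the constant `l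
+ 1/2 + μ_σ`.

To solve it (`sum_compProd_of_recursion`), put `N = p + μ_α + 1/2` and `T_k = ∑_l h_{l,ε}
(R_{p-l,k})^ε_α`. The entry `(R_{p-l,k})^ε_α` vanishes unless `μ_ε - μ_α = p - l`, and then `l + 1/2
+ μ_ε = N`; hence `∑_l b_{l,ε} (R_{p-l,k})^ε_α = N T_k + T_{k+1}`. Weighted by `(-1)^k / N^{k+1}`
and summed over `k`, this telescopes to `T_0 = h_{p,α}`, because `T_{p+1} = 0`. -/

theorem hasFPowerSeriesAt_of_eventually_hasSum {a : ℕ → ℂ} {f : ℂ → ℂ}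
    (h : ∀ᶠ z in 𝓝 (0 : ℂ), HasSum (fun p => a p * z ^ p) (f z)) :
    HasFPowerSeriesAt f (FormalMultilinearSeries.ofScalars ℂ a) 0 := by
  rw [hasFPowerSeriesAt_iff]
  filter_upwards [h] with z hz
  simpa [FormalMultilinearSeries.coeff_ofScalars, mul_comm] using hz

/-- Zeros of a nonzero analytic function are isolated. This form allows equations known only off the
branch cut to be compared coefficientwise. -/
theorem coeff_eq_zero_of_frequently_eq_zero {a : ℕ → ℂ} {f : ℂ → ℂ}
    (h : ∀ᶠ z in 𝓝 (0 : ℂ), HasSum (fun p => a p * z ^ p) (f z))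
    (h0 : ∃ᶠ z in 𝓝[≠] (0 : ℂ), f z = 0) (p : ℕ) : a p = 0 := by
  have hf := hasFPowerSeriesAt_of_eventually_hasSum h
  have he : f =ᶠ[𝓝 0] 0 := hf.analyticAt.frequently_zero_iff_eventually_zero.1 h0
  have hz := (hf.congr he).eq_zero
  rw [← FormalMultilinearSeries.coeff_ofScalars (𝕜 := ℂ) (p := a) (n := p), hz]
  rfl

/-- Termwise differentiation, with the Euler operator `z d/dz` in place of `d/dz` so that no index
is shifted. -/
theorem eventually_hasDerivAt_of_hasSum {a : ℕ → ℂ} {f : ℂ → ℂ}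
    (h : ∀ᶠ z in 𝓝 (0 : ℂ), HasSum (fun p => a p * z ^ p) (f z)) :
    ∀ᶠ z in 𝓝 (0 : ℂ), DifferentiableAt ℂ f z ∧
      HasSum (fun p : ℕ => (p : ℂ) * a p * z ^ p) (z * deriv f z) := by
  have hf := hasFPowerSeriesAt_of_eventually_hasSum h
  obtain ⟨r, hr⟩ := id hf
  filter_upwards [hf.analyticAt.eventually_analyticAt, Metric.eball_mem_nhds (0 : ℂ) hr.r_pos]
    with z hz hzr
  refine ⟨hz.differentiableAt, ?_⟩
  have h1 := (hr.fderiv).hasSum hzr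
  rw [zero_add] at h1
  have h2 := h1.mapL (ContinuousLinearMap.apply ℂ ℂ z)
  simp only [ContinuousLinearMap.apply_apply,
    FormalMultilinearSeries.derivSeries_apply_diag] at h2
  rw [← hasSum_nat_add_iff' 1]
  have h3 : fderiv ℂ f z z = z * deriv f z := by
    rw [← toSpanSingleton_deriv]; simp
  rw [h3] at h2
  convert h2 using 1
  · funext p
    simp [FormalMultilinearSeries.ofScalars]
    ring
  · simp

theorem hasSum_shift {a : ℕ → ℂ} {s z : ℂ} (h : HasSum (fun p => a p * z ^ p) s) (k : ℕ) :
    HasSum (fun p => (if k ≤ p then a (p - k) else 0) * z ^ p) (z ^ k * s) := by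
  rw [← hasSum_nat_add_iff' k]
  have : ∑ i ∈ Finset.range k, (if k ≤ i then a (i - k) else 0) * z ^ i = 0 :=
    Finset.sum_eq_zero fun i hi => by simp [Nat.not_le.2 (Finset.mem_range.1 hi)]
  rw [this, sub_zero]
  refine (h.mul_left (z ^ k)).congr_fun fun p => ?_
  simp [pow_add]
  ring

namespace WDVVSolution
variable {n : ℕ} [NeZero n] (M : WDVVSolution n)

/-! ### The matrices `R_{k,l}` -/

/-- For length `0` the only tuple is the empty one, of sum `0`, so the separate clause of the
definition is an instance of the general formula. -/
theorem compProd_eq_sum (R : Matrix (Fin n) (Fin n) ℂ) (m k : ℕ) :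
    M.compProd R m k =
      ∑ i ∈ (Finset.Nat.antidiagonalTuple k m).filter (fun i => ∀ j, 1 ≤ i j),
        (List.ofFn fun j => M.comp R (i j)).prod := by
  cases k with
  | zero =>
    cases m with
    | zero => simp [compProd]
    | succ m => simp [compProd]
  | succ k => rfl

/-- Splits off the first factor `R_{i_1}` of each product. -/
theorem compProd_succ (R : Matrix (Fin n) (Fin n) ℂ) (m k : ℕ) :
    M.compProd R m (k + 1) =
      ∑ j ∈ Finset.Icc 1 m, M.comp R j * M.compProd R (m - j) k := by
  rw [compProd_eq_sum]
  simp only [compProd_eq_sum, Finset.mul_sum]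
  rw [Finset.sum_sigma']
  refine Finset.sum_bij' (fun i _ => ⟨i 0, Fin.tail i⟩) (fun x _ => Fin.cons x.1 x.2)
    ?_ ?_ ?_ ?_ ?_
  · intro i hi
    simp only [Finset.mem_filter, Finset.Nat.mem_antidiagonalTuple, Fin.sum_univ_succ] at hi
    simp only [Finset.mem_sigma, Finset.mem_Icc, Finset.mem_filter,
      Finset.Nat.mem_antidiagonalTuple, Fin.tail]
    have := hi.2 0
    exact ⟨by omega, by omega, fun j => hi.2 _⟩
  · rintro ⟨j, i⟩ hx
    simp only [Finset.mem_sigma, Finset.mem_Icc, Finset.mem_filter,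
      Finset.Nat.mem_antidiagonalTuple] at hx
    simp only [Finset.mem_filter, Finset.Nat.mem_antidiagonalTuple, Fin.sum_univ_succ,
      Fin.cons_zero, Fin.cons_succ, Fin.forall_fin_succ]
    exact ⟨by omega, hx.1.1, hx.2.2⟩
  · intro i _
    simp
  · rintro ⟨j, i⟩ _
    simp
  · intro i _
    rw [List.ofFn_succ, List.prod_cons]
    rfl

theorem comp_apply_ne_zero {R : Matrix (Fin n) (Fin n) ℂ} {k : ℕ} {α β : Fin n}
    (h : M.comp R k α β ≠ 0) : M.mu α - M.mu β = k := by
  by_contra hne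
  exact h (by simp [comp, hne])

/-- Each `R_j` is homogeneous of degree `j` for the grading by `μ`, and degrees add under products.
-/
theorem compProd_apply_ne_zero (R : Matrix (Fin n) (Fin n) ℂ) (k : ℕ) :
    ∀ (m : ℕ) (α β : Fin n), M.compProd R m k α β ≠ 0 → M.mu α - M.mu β = m := by
  induction k with
  | zero =>
    intro m α β h
    by_cases hm : m = 0
    · subst hm
      by_cases hab : α = β
      · simp [hab]
      · simp [compProd, hab] at h
    · simp [compProd, hm] at h
  | succ k ih =>
    intro m α β h
    rw [compProd_succ, Matrix.sum_apply] at h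
    obtain ⟨j, hj, h⟩ := Finset.exists_ne_zero_of_sum_ne_zero h
    rw [Matrix.mul_apply] at h
    obtain ⟨σ, _, h⟩ := Finset.exists_ne_zero_of_sum_ne_zero h
    have h1 := M.comp_apply_ne_zero (left_ne_zero_of_mul h)
    have h2 := ih _ _ _ (right_ne_zero_of_mul h)
    rw [Nat.cast_sub (Finset.mem_Icc.1 hj).2] at h2
    linear_combination h1 + h2

/-- Summing the recursion `b_l = h_l (l + 1/2 + μ) + ∑ h_{l-k} R_k` against the matrices `R_{k,l}`
recovers `h_p`. -/
theorem sum_compProd_of_recursion (R : Matrix (Fin n) (Fin n) ℂ) (h b : ℕ → Fin n → ℂ)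
    (hb : ∀ l α, b l α = ((l : ℂ) + 1 / 2 + M.mu α) * h l α +
      ∑ k ∈ Finset.Icc 1 l, ∑ σ, h (l - k) σ * M.comp R k σ α)
    (α : Fin n) (p : ℕ) (hp : (p : ℂ) + M.mu α + 1 / 2 ≠ 0) :
    ∑ k ∈ Finset.range (p + 1), ∑ l ∈ Finset.range (p + 1), ∑ ε,
      (-1) ^ k * M.compProd R (p - l) k ε α * b l ε / ((p : ℂ) + M.mu α + 1 / 2) ^ (k + 1) =
    h p α := by
  set N : ℂ := (p : ℂ) + M.mu α + 1 / 2 with hN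
  set T : ℕ → ℂ := fun k => ∑ l ∈ Finset.range (p + 1), ∑ ε,
    h l ε * M.compProd R (p - l) k ε α with hT
  have hT0 : T 0 = h p α := by
    simp only [hT]
    rw [Finset.sum_eq_single p]
    · simp [compProd, Matrix.one_apply]
    · intro l hl hlp
      have : p - l ≠ 0 := by have := Finset.mem_range.1 hl; omega
      simp [compProd, this]
    · simp
  have hTp : T (p + 1) = 0 := by
    refine Finset.sum_eq_zero fun l _ => Finset.sum_eq_zero fun ε _ => ?_
    rw [M.compProd_eq_zero R (by omega)]
    simp
  have key : ∀ k, ∑ l ∈ Finset.range (p + 1), ∑ ε, M.compProd R (p - l) k ε α * b l ε =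
      N * T k + T (k + 1) := by
    intro k
    have e1 : ∀ l ∈ Finset.range (p + 1), ∀ ε, M.compProd R (p - l) k ε α * b l ε =
        N * (h l ε * M.compProd R (p - l) k ε α) +
        ∑ j ∈ Finset.Icc 1 l, ∑ σ,
          h (l - j) σ * (M.comp R j σ ε * M.compProd R (p - l) k ε α) := by
      intro l hl ε
      have hle : l ≤ p := Nat.lt_succ_iff.1 (Finset.mem_range.1 hl)
      rw [hb, mul_add]
      congr 1
      -- On the support of `R_{p-l,k}` the grading makes the factor `l + 1/2 + μ_ε` equal to `N`,
      -- independently of `l` and `ε`.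
      · by_cases h0 : M.compProd R (p - l) k ε α = 0
        · simp [h0]
        · have := M.compProd_apply_ne_zero R k _ _ _ h0
          rw [Nat.cast_sub hle] at this
          have e : (l : ℂ) + 1 / 2 + M.mu ε = N := by rw [hN]; linear_combination this
          rw [e]; ring
      · simp only [Finset.mul_sum]
        refine Finset.sum_congr rfl fun j _ => Finset.sum_congr rfl fun σ _ => by ring
    rw [Finset.sum_congr rfl fun l hl => Finset.sum_congr rfl fun ε _ => e1 l hl ε]
    simp only [Finset.sum_add_distrib]
    congr 1
    · simp only [hT, Finset.mul_sum]
    · have e2 : ∀ l, ∑ ε, ∑ j ∈ Finset.Icc 1 l, ∑ σ,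
          h (l - j) σ * (M.comp R j σ ε * M.compProd R (p - l) k ε α) =
          ∑ j ∈ Finset.Icc 1 l, ∑ σ,
            h (l - j) σ * (M.comp R j * M.compProd R (p - l) k) σ α := by
        intro l
        rw [Finset.sum_comm]
        refine Finset.sum_congr rfl fun j _ => ?_
        rw [Finset.sum_comm]
        simp only [Matrix.mul_apply, Finset.mul_sum]
      have e3 : ∀ l, ∑ ε, h l ε * M.compProd R (p - l) (k + 1) ε α =
          ∑ j ∈ Finset.Icc 1 (p - l), ∑ ε,
            h l ε * (M.comp R j * M.compProd R (p - l - j) k) ε α := by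
        intro l
        rw [compProd_succ, Finset.sum_comm]
        simp only [Matrix.sum_apply, Finset.mul_sum]
      simp only [hT, e2, e3]
      rw [Finset.sum_sigma' (Finset.range (p + 1)) (fun l => Finset.Icc 1 l),
        Finset.sum_sigma' (Finset.range (p + 1)) (fun l => Finset.Icc 1 (p - l))]
      -- The substitution `l ↦ l - j` maps the pairs `1 ≤ j ≤ l ≤ p` onto the pairs with `1 ≤ j ≤ p
      -- - l`.
      refine Finset.sum_bij' (fun x _ => ⟨x.1 - x.2, x.2⟩) (fun x _ => ⟨x.1 + x.2, x.2⟩)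
        ?_ ?_ ?_ ?_ ?_
      · rintro ⟨l, j⟩ hx
        simp only [Finset.mem_sigma, Finset.mem_range, Finset.mem_Icc] at hx ⊢
        omega
      · rintro ⟨l, j⟩ hx
        simp only [Finset.mem_sigma, Finset.mem_range, Finset.mem_Icc] at hx ⊢
        omega
      · rintro ⟨l, j⟩ hx
        simp only [Finset.mem_sigma, Finset.mem_range, Finset.mem_Icc] at hx
        simp only [Sigma.mk.injEq, heq_eq_eq, and_true]
        omega
      · rintro ⟨l, j⟩ hx
        simp
      · rintro ⟨l, j⟩ hx
        simp only [Finset.mem_sigma, Finset.mem_range, Finset.mem_Icc] at hx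
        have : p - (l - j) - j = p - l := by omega
        simp only [this]
  -- Dividing `N T_k + T_{k+1}` by `N^{k+1}` with alternating signs gives a telescoping difference;
  -- this needs `N ≠ 0`.
  have e4 : ∀ k, ∑ l ∈ Finset.range (p + 1), ∑ ε,
      (-1) ^ k * M.compProd R (p - l) k ε α * b l ε / N ^ (k + 1) =
      (-1) ^ k * T k / N ^ k - (-1) ^ (k + 1) * T (k + 1) / N ^ (k + 1) := by
    intro k
    have : ∑ l ∈ Finset.range (p + 1), ∑ ε,
        (-1) ^ k * M.compProd R (p - l) k ε α * b l ε / N ^ (k + 1) =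
        (-1) ^ k / N ^ (k + 1) *
          ∑ l ∈ Finset.range (p + 1), ∑ ε, M.compProd R (p - l) k ε α * b l ε := by
      simp only [Finset.mul_sum]
      refine Finset.sum_congr rfl fun l _ => Finset.sum_congr rfl fun ε _ => by ring
    rw [this, key]
    field_simp
    ring
  simp only [e4]
  rw [Finset.sum_range_sub', hTp, hT0]
  simp

end WDVVSolution
end GenusZero

namespace GenusZero
open Filter Topology

/-! ### The equation in `z` and its Taylor coefficients -/

theorem frequently_slitPlane_nhdsNE_zero : ∃ᶠ z in 𝓝[≠] (0 : ℂ), z ∈ Complex.slitPlane := by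
  have ht : Tendsto (fun x : ℝ => (x : ℂ)) (𝓝[>] 0) (𝓝[≠] (0 : ℂ)) := by
    refine tendsto_nhdsWithin_iff.2 ⟨?_, ?_⟩
    · have := Complex.continuous_ofReal.tendsto 0
      exact (by simpa using this : Tendsto _ _ _).mono_left nhdsWithin_le_nhds
    · filter_upwards [self_mem_nhdsWithin] with x hx
      exact Complex.ofReal_ne_zero.2 (ne_of_gt hx)
  refine ht.frequently (Eventually.frequently ?_)
  filter_upwards [self_mem_nhdsWithin] with x hx
  exact Complex.ofReal_mem_slitPlane.2 hx

theorem isUnit_zpowMatrix {n : ℕ} (R : Matrix (Fin n) (Fin n) ℂ) (z : ℂ) :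
    IsUnit (zpowMatrix R z) :=
  Matrix.isUnit_exp _

-- The norm only supplies a Banach algebra in which to differentiate `exp`; the statement is about
-- entries and does not depend on it.
open scoped Matrix.Norms.Operator in
theorem hasDerivAt_zpowMatrix {n : ℕ} (R : Matrix (Fin n) (Fin n) ℂ) {z : ℂ}
    (hz : z ∈ Complex.slitPlane) (α β : Fin n) :
    HasDerivAt (fun w => zpowMatrix R w α β) (z⁻¹ * (R * zpowMatrix R z) α β) z := by
  have h1 : HasDerivAt (fun u : ℂ => NormedSpace.exp (u • R))
      (R * NormedSpace.exp (Complex.log z • R)) (Complex.log z) :=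
    hasDerivAt_exp_smul_const' R (Complex.log z)
  have h2 := h1.scomp z (Complex.hasDerivAt_log hz)
  have h3 := (LinearMap.toContinuousLinearMap
    (Matrix.entryLinearMap ℂ ℂ α β)).hasFDerivAt.comp_hasDerivAt z h2
  exact h3

section
variable {n : ℕ} [NeZero n] (M : WDVVSolution n) (θ : Fin n → ℕ → (Fin n → ℂ) → ℂ)

theorem eta_mul_gradCoeff (p : ℕ) (t : Fin n → ℂ) :
    M.η * gradCoeff M θ p t = Matrix.of fun α β => pd α (θ β p) t := by
  have h : gradCoeff M θ p t = M.η⁻¹ * Matrix.of fun α β => pd α (θ β p) t := by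
    ext α β
    simp [gradCoeff, Matrix.mul_apply]
  rw [h, Matrix.mul_nonsing_inv_cancel_left _ _ M.eta_nondeg]

/-- Lowering the index with `η` replaces gradients by differentials, whose Taylor coefficients are
plain partial derivatives. -/
theorem hasSum_eta_mul_gradSeries {t : Fin n → ℂ} {z : ℂ}
    (h : ∀ α β, Summable fun p => gradCoeff M θ p t α β * z ^ p) (α β : Fin n) :
    HasSum (fun p => pd α (θ β p) t * z ^ p) ((M.η * gradSeries M θ t z) α β) := by
  have h1 : HasSum (fun p => ∑ γ, M.η α γ * (gradCoeff M θ p t γ β * z ^ p))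
      (∑ γ, M.η α γ * ∑' p, gradCoeff M θ p t γ β * z ^ p) :=
    hasSum_sum fun γ _ => ((h γ β).hasSum).mul_left _
  rw [Matrix.mul_apply]
  refine h1.congr_fun fun p => ?_
  have := congrFun (congrFun (eta_mul_gradCoeff M θ p t) α) β
  rw [Matrix.mul_apply, Matrix.of_apply] at this
  rw [← this, Finset.sum_mul]
  exact Finset.sum_congr rfl fun γ _ => by ring

/-- `z^μ R = (∑ R_k z^k) z^μ`, where `κ` records the integers `μ_α - μ_β`. -/
theorem diagonal_cpow_mul {R : Matrix (Fin n) (Fin n) ℂ} {κ : Fin n → Fin n → ℕ}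
    (hκ : ∀ α β, R α β ≠ 0 → M.mu α - M.mu β = κ α β) {z : ℂ} (hz : z ≠ 0) :
    Matrix.diagonal (fun α => z ^ M.mu α) * R =
      Matrix.of (fun α β => R α β * z ^ κ α β) * Matrix.diagonal (fun α => z ^ M.mu α) := by
  ext α β
  rw [Matrix.diagonal_mul, Matrix.mul_diagonal, Matrix.of_apply]
  by_cases h : R α β = 0
  · simp [h]
  · have : M.mu α = κ α β + M.mu β := by rw [← hκ α β h]; ring
    rw [this, Complex.cpow_add _ _ hz, Complex.cpow_natCast]
    ring

/-- The equation satisfied by `S = η (∇θ_1, …, ∇θ_n)` when `S z^μ z^R` is flat in `z`. -/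
theorem series_equation_of_isFlatInZ {R : Matrix (Fin n) (Fin n) ℂ} {κ : Fin n → Fin n → ℕ}
    (hκ : ∀ α β, R α β ≠ 0 → M.mu α - M.mu β = κ α β) {t : Fin n → ℂ} {z : ℂ}
    (hz : z ∈ Complex.slitPlane)
    (hd : ∀ α β, DifferentiableAt ℂ (fun w => (M.η * gradSeries M θ t w) α β) z)
    (hflat : IsFlatInZ M t (fundMatrix M θ R t) z) (α β : Fin n) :
    z * deriv (fun w => (M.η * gradSeries M θ t w) α β) z +
        (M.mu α + M.mu β) * (M.η * gradSeries M θ t z) α β +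
        ∑ σ, (M.η * gradSeries M θ t z) α σ * (R σ β * z ^ κ σ β) =
      z * ∑ γ, M.eulerMul t γ α * (M.η * gradSeries M θ t z) γ β := by
  have hz0 : z ≠ 0 := Complex.slitPlane_ne_zero hz
  set S : ℂ → Matrix (Fin n) (Fin n) ℂ := fun w => M.η * gradSeries M θ t w with hS
  set S' : Matrix (Fin n) (Fin n) ℂ := Matrix.of fun α β => deriv (fun w => S w α β) z with hS'
  set D : ℂ → Matrix (Fin n) (Fin n) ℂ := fun w => Matrix.diagonal fun α => w ^ M.mu α with hD
  set P : ℂ → Matrix (Fin n) (Fin n) ℂ := fun w => D w * zpowMatrix R w with hP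
  set Q : Matrix (Fin n) (Fin n) ℂ := Matrix.of fun α β => R α β * z ^ κ α β with hQ
  have hSP : ∀ w, M.η * fundMatrix M θ R t w = S w * P w := fun w => by
    simp only [fundMatrix, hS, hP, hD, Matrix.mul_assoc]
  -- `P = z^μ z^R` satisfies `z P' = (μ + Q) P`: moving `R` to the left of `z^μ` turns it into `Q =
  -- ∑ R_k z^k`.
  have hPd : ∀ σ β, HasDerivAt (fun w => P w σ β)
      ((z⁻¹ • ((Matrix.diagonal M.mu + Q) * P z)) σ β) z := by
    intro σ β
    have h1 : HasDerivAt (fun w : ℂ => w ^ M.mu σ) (M.mu σ * z ^ (M.mu σ - 1)) z := by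
      simpa using (hasDerivAt_id z).cpow_const (c := M.mu σ) hz
    have h2 := h1.mul (hasDerivAt_zpowMatrix R hz σ β)
    have e : Q * P z = D z * (R * zpowMatrix R z) := by
      have := diagonal_cpow_mul M hκ hz0
      simp only [hP, hD, hQ, ← Matrix.mul_assoc, this]
    have e2 : (fun w => P w σ β) = (fun w : ℂ => w ^ M.mu σ) * fun w => zpowMatrix R w σ β := by
      funext w
      simp only [hP, hD, Matrix.diagonal_mul, Pi.mul_apply]
    rw [e2]
    refine h2.congr_deriv ?_
    rw [add_mul, e, Matrix.smul_apply, Matrix.add_apply, Matrix.diagonal_mul]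
    simp only [hP, hD, Matrix.diagonal_mul, smul_eq_mul]
    rw [Complex.cpow_sub _ _ hz0, Complex.cpow_one]
    field_simp
  have hPu : IsUnit (P z) := by
    refine IsUnit.mul ?_ (isUnit_zpowMatrix R z)
    rw [Matrix.isUnit_iff_isUnit_det, Matrix.det_diagonal, isUnit_iff_ne_zero]
    exact Finset.prod_ne_zero_iff.2 fun α _ => by simp [Complex.cpow_eq_zero_iff, hz0]
  have hmat : S' * P z + S z * (z⁻¹ • ((Matrix.diagonal M.mu + Q) * P z)) =
      (M.eulerMul t - z⁻¹ • Matrix.diagonal M.mu).transpose * (S z * P z) := by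
    ext α β
    have h1 := hflat α β
    simp only [hSP] at h1
    have h2 : HasDerivAt (fun w => (S w * P w) α β)
        (∑ σ, (S' α σ * P z σ β +
          S z α σ * (z⁻¹ • ((Matrix.diagonal M.mu + Q) * P z)) σ β)) z := by
      simp only [Matrix.mul_apply]
      exact HasDerivAt.fun_sum fun σ _ => (hd α σ).hasDerivAt.mul (hPd σ β)
    refine Eq.trans ?_ (h2.unique h1)
    rw [Finset.sum_add_distrib]
    rfl
  -- Both sides end in the invertible matrix `P z`. Cancelling it removes all multivalued functions
  -- and leaves an equation for the power series `S`.
  have hcancel : S' + z⁻¹ • (S z * (Matrix.diagonal M.mu + Q)) =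
      (M.eulerMul t - z⁻¹ • Matrix.diagonal M.mu).transpose * S z := by
    refine hPu.mul_left_injective ?_
    simp only [add_mul, Matrix.smul_mul, Matrix.mul_smul, Matrix.mul_assoc, mul_add] at hmat ⊢
    exact hmat
  have hent := congrFun (congrFun hcancel α) β
  rw [Matrix.transpose_sub, Matrix.transpose_smul, Matrix.diagonal_transpose, sub_mul, mul_add,
    Matrix.smul_mul, Matrix.add_apply, Matrix.smul_apply, Matrix.add_apply, Matrix.mul_diagonal,
    Matrix.sub_apply, Matrix.smul_apply, Matrix.diagonal_mul, Matrix.mul_apply,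
    Matrix.mul_apply] at hent
  simp only [hS', hQ, Matrix.of_apply, Matrix.transpose_apply, smul_eq_mul] at hent
  have := congrArg (fun x => z * x) hent
  simp only [mul_add, mul_sub, mul_inv_cancel_left₀ hz0] at this
  linear_combination this

variable {M θ}

/-- The Taylor coefficients in `z` of the equation `∇̃_{d/dz} dt̃ = 0`. -/
theorem IsDeformedFlat.coeff_recursion {R : Matrix (Fin n) (Fin n) ℂ}
    (hθ : IsDeformedFlat M θ R) {t : Fin n → ℂ} (ht : t ∈ M.U) (p : ℕ) (α β : Fin n) :
    ((p : ℂ) + M.mu α + M.mu β) * pd α (θ β p) t +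
        ∑ k ∈ Finset.Icc 1 p, ∑ σ, pd α (θ σ (p - k)) t * M.comp R k σ β =
      if 1 ≤ p then ∑ γ, M.eulerMul t γ α * pd γ (θ β (p - 1)) t else 0 := by
  -- Where `R` vanishes the degree is set to `1`, so that every shift is positive and the sum over
  -- `k` can start at `1`.
  have hk : ∀ α β, ∃ k : ℕ, 0 < k ∧ (R α β ≠ 0 → M.mu α - M.mu β = k) := by
    intro α β
    by_cases h : R α β = 0
    · exact ⟨1, one_pos, fun h' => absurd h h'⟩
    · obtain ⟨k, hk0, hk⟩ := hθ.R_support α β h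
      exact ⟨k, hk0, fun _ => hk⟩
  choose κ hκ0 hκ using hk
  have hcomp : ∀ k σ β, M.comp R k σ β = if k = κ σ β then R σ β else 0 := by
    intro k σ β
    by_cases h : R σ β = 0
    · simp [WDVVSolution.comp, h]
    · simp only [WDVVSolution.comp, Matrix.of_apply, hκ σ β h, Nat.cast_inj, eq_comm]
  obtain ⟨ρ, hρ, hsum, -, hflat⟩ := hθ.fund t ht
  have hball : ∀ᶠ z in 𝓝 (0 : ℂ), ‖z‖ < ρ := by
    filter_upwards [Metric.ball_mem_nhds (0 : ℂ) hρ] with z hz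
    simpa using hz
  have hS : ∀ᶠ z in 𝓝 (0 : ℂ), ∀ α β, HasSum (fun p => pd α (θ β p) t * z ^ p)
      ((M.η * gradSeries M θ t z) α β) :=
    hball.mono fun z hz => hasSum_eta_mul_gradSeries M θ (hsum z hz)
  have hS' : ∀ᶠ z in 𝓝 (0 : ℂ), ∀ α β,
      DifferentiableAt ℂ (fun w => (M.η * gradSeries M θ t w) α β) z ∧
      HasSum (fun p : ℕ => (p : ℂ) * pd α (θ β p) t * z ^ p)
        (z * deriv (fun w => (M.η * gradSeries M θ t w) α β) z) := by
    simp only [eventually_all]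
    exact fun α β => eventually_hasDerivAt_of_hasSum (hS.mono fun z hz => hz α β)
  -- The difference of the two sides as a single power series; the conditionals set coefficients of
  -- negative index to zero.
  have hG : ∀ᶠ z in 𝓝 (0 : ℂ), HasSum (fun p : ℕ =>
      ((p : ℂ) * pd α (θ β p) t + (M.mu α + M.mu β) * pd α (θ β p) t +
        ∑ σ, (if κ σ β ≤ p then pd α (θ σ (p - κ σ β)) t else 0) * R σ β -
        ∑ γ, M.eulerMul t γ α * (if 1 ≤ p then pd γ (θ β (p - 1)) t else 0)) * z ^ p)
      (z * deriv (fun w => (M.η * gradSeries M θ t w) α β) z +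
        (M.mu α + M.mu β) * (M.η * gradSeries M θ t z) α β +
        ∑ σ, (M.η * gradSeries M θ t z) α σ * (R σ β * z ^ κ σ β) -
      z * ∑ γ, M.eulerMul t γ α * (M.η * gradSeries M θ t z) γ β) := by
    filter_upwards [hS, hS'] with z h1 h2
    have a1 := (h2 α β).2
    have a2 := (h1 α β).mul_left (M.mu α + M.mu β)
    have a3 := hasSum_sum fun σ (_ : σ ∈ Finset.univ) =>
      (hasSum_shift (h1 α σ) (κ σ β)).mul_left (R σ β)
    have a4 := hasSum_sum fun γ (_ : γ ∈ Finset.univ) =>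
      (hasSum_shift (h1 γ β) 1).mul_left (M.eulerMul t γ α)
    have a := ((a1.add a2).add a3).sub a4
    have e : z * deriv (fun w => (M.η * gradSeries M θ t w) α β) z +
        (M.mu α + M.mu β) * (M.η * gradSeries M θ t z) α β +
        ∑ σ, (M.η * gradSeries M θ t z) α σ * (R σ β * z ^ κ σ β) -
        z * ∑ γ, M.eulerMul t γ α * (M.η * gradSeries M θ t z) γ β =
        z * deriv (fun w => (M.η * gradSeries M θ t w) α β) z +
        (M.mu α + M.mu β) * (M.η * gradSeries M θ t z) α β +
        ∑ σ, R σ β * (z ^ κ σ β * (M.η * gradSeries M θ t z) α σ) -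
        ∑ γ, M.eulerMul t γ α * (z ^ 1 * (M.η * gradSeries M θ t z) γ β) := by
      rw [Finset.mul_sum]
      congr 1
      · congr 1
        exact Finset.sum_congr rfl fun σ _ => by ring
      · exact Finset.sum_congr rfl fun σ _ => by ring
    rw [e]
    refine a.congr_fun fun p => ?_
    simp only [sub_mul, add_mul, Finset.sum_mul]
    congr 1
    · congr 1
      · ring
      · exact Finset.sum_congr rfl fun σ _ => by ring
    · exact Finset.sum_congr rfl fun σ _ => by ring
  -- The equation holds only on the slit plane, but that set accumulates at `0`, which suffices for
  -- the coefficients to vanish.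
  have hzero := coeff_eq_zero_of_frequently_eq_zero hG
    ((frequently_slitPlane_nhdsNE_zero.and_eventually
      ((hball.and hS').filter_mono nhdsWithin_le_nhds)).mono fun z hz =>
        sub_eq_zero.2 (series_equation_of_isFlatInZ M θ hκ hz.1 (fun α β => (hz.2.2 α β).1)
          (hflat z hz.1 hz.2.1) α β)) p
  have e1 : ∑ k ∈ Finset.Icc 1 p, ∑ σ, pd α (θ σ (p - k)) t * M.comp R k σ β =
      ∑ σ, (if κ σ β ≤ p then pd α (θ σ (p - κ σ β)) t else 0) * R σ β := by
    rw [Finset.sum_comm]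
    refine Finset.sum_congr rfl fun σ _ => ?_
    simp only [hcomp, mul_ite, mul_zero, Finset.sum_ite_eq', Finset.mem_Icc]
    have := hκ0 σ β
    by_cases h : κ σ β ≤ p
    · simp [h, Nat.succ_le_of_lt this]
    · simp [h]
  have e2 : (if 1 ≤ p then ∑ γ, M.eulerMul t γ α * pd γ (θ β (p - 1)) t else 0) =
      ∑ γ, M.eulerMul t γ α * (if 1 ≤ p then pd γ (θ β (p - 1)) t else 0) := by
    split_ifs <;> simp
  rw [e1, e2]
  linear_combination hzero

end
end GenusZero

namespace GenusZero
open Filter Topology MeasureTheory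

/-! ### Partial derivatives and variational derivatives of local functionals -/

section
variable {n : ℕ}

theorem fderiv_apply_eq_sum_pd (f : (Fin n → ℂ) → ℂ) (t w : Fin n → ℂ) :
    fderiv ℂ f t w = ∑ β, pd β f t * w β := by
  have : w = ∑ β, w β • (Pi.single β 1 : Fin n → ℂ) := by
    ext i
    simp [Finset.sum_apply, Pi.single_apply]
  conv_lhs => rw [this]
  rw [map_sum]
  exact Finset.sum_congr rfl fun β _ => by rw [map_smul, smul_eq_mul, mul_comm]; rfl

theorem _root_.AnalyticOnNhd.pd {f : (Fin n → ℂ) → ℂ} {U : Set (Fin n → ℂ)}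
    (hf : AnalyticOnNhd ℂ f U) (β : Fin n) : AnalyticOnNhd ℂ (pd β f) U := fun t ht =>
  ((ContinuousLinearMap.apply ℂ ℂ (Pi.single β 1 : Fin n → ℂ)).analyticAt _).comp (hf.fderiv t ht)

theorem pd_comm {f : (Fin n → ℂ) → ℂ} {U : Set (Fin n → ℂ)} (hf : AnalyticOnNhd ℂ f U)
    {t : Fin n → ℂ} (ht : t ∈ U) (α β : Fin n) : pd α (pd β f) t = pd β (pd α f) t := by
  have hd : DifferentiableAt ℂ (fderiv ℂ f) t := (hf.fderiv t ht).differentiableAt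
  have h : ∀ α β : Fin n, pd α (pd β f) t =
      fderiv ℂ (fderiv ℂ f) t (Pi.single α 1) (Pi.single β 1) := by
    intro α β
    have : pd β f = fun s => fderiv ℂ f s (Pi.single β 1) := rfl
    rw [this]
    unfold pd
    rw [fderiv_clm_apply hd (differentiableAt_const _)]
    simp
  rw [h, h]
  exact ((hf t ht).contDiffAt (n := 2)).isSymmSndFDerivAt (by simp) _ _

theorem hasDerivAt_comp_loop {f : (Fin n → ℂ) → ℂ} {v : ℝ → Fin n → ℂ} {X : ℝ}
    (hf : AnalyticAt ℂ f (v X)) (hv : DifferentiableAt ℝ v X) :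
    HasDerivAt (fun Y => f (v Y)) (∑ γ, pd γ f (v X) * deriv (fun Y => v Y γ) X) X := by
  have h := (hf.differentiableAt.hasFDerivAt.restrictScalars ℝ).comp_hasDerivAt X hv.hasDerivAt
  refine h.congr_deriv ?_
  rw [ContinuousLinearMap.coe_restrictScalars', fderiv_apply_eq_sum_pd]
  refine Finset.sum_congr rfl fun γ _ => ?_
  rw [(hasDerivAt_pi.1 hv.hasDerivAt γ).deriv]

theorem IsSmoothLoop.comp_analytic {m : ℕ} {L : ℝ} {v : ℝ → Fin n → ℂ} (hv : IsSmoothLoop L v)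
    {U : Set (Fin n → ℂ)} (hvU : ∀ X, v X ∈ U) {f : Fin m → (Fin n → ℂ) → ℂ}
    (hf : ∀ i, AnalyticOnNhd ℂ (f i) U) : IsSmoothLoop L fun X i => f i (v X) := by
  refine ⟨contDiff_pi.2 fun i => contDiff_iff_contDiffAt.2 fun X => ?_, fun X => ?_⟩
  · exact (((hf i (v X) (hvU X)).contDiffAt (n := ∞)).restrict_scalars ℝ).comp X
      hv.1.contDiffAt
  · funext i
    simp only [hv.2 X]

/-- The variational derivative of `∫ f(v) dX` is `∂f/∂v`. -/
theorem hasVarDeriv_integral {L : ℝ} (hL : 0 < L) {f : (Fin n → ℂ) → ℂ} {U : Set (Fin n → ℂ)}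
    (hU : IsOpen U) (hf : AnalyticOnNhd ℂ f U) {v : ℝ → Fin n → ℂ} (hv : IsSmoothLoop L v)
    (hvU : ∀ X, v X ∈ U) :
    HasVarDeriv L (fun u => ∫ X in (0 : ℝ)..L, f (u X)) v fun X β => pd β f (v X) := by
  refine ⟨hv.comp_analytic hvU fun β => hf.pd β, fun w hw => ?_⟩
  have hvc : Continuous v := hv.1.continuous
  have hwc : Continuous w := hw.1.continuous
  set u : ℂ × ℝ → Fin n → ℂ := fun x => v x.2 + x.1 • w x.2 with hu
  have huc : Continuous u := by fun_prop
  have hW : IsOpen (u ⁻¹' U) := hU.preimage huc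
  -- As `[0, L]` is compact, `v + s w` stays in `U` over it for all complex `s` in a small disc.
  obtain ⟨V, K, hV, -, h0V, hKV, hVK⟩ := generalized_tube_lemma
    (isCompact_singleton (x := (0 : ℂ))) (isCompact_Icc (a := (0 : ℝ)) (b := L)) hW
    (by
      rintro ⟨s, X⟩ ⟨hs, -⟩
      have hs : s = 0 := hs
      simpa [hu, hs] using hvU X)
  obtain ⟨ε, hε, hεV⟩ := Metric.nhds_basis_closedBall.mem_iff.1
    (hV.mem_nhds (h0V (Set.mem_singleton (0 : ℂ))))
  have hmem : ∀ s ∈ Metric.closedBall (0 : ℂ) ε, ∀ X ∈ Set.Icc 0 L, u (s, X) ∈ U :=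
    fun s hs X hX => hVK ⟨hεV hs, hKV hX⟩
  set F' : ℂ → ℝ → ℂ := fun s X => ∑ β, pd β f (u (s, X)) * w X β with hF'
  have hcont : ContinuousOn (fun x : ℂ × ℝ => F' x.1 x.2)
      (Metric.closedBall (0 : ℂ) ε ×ˢ Set.Icc 0 L) := by
    refine continuousOn_finsetSum _ fun β _ => ContinuousOn.mul ?_ (by fun_prop)
    exact (hf.pd β).continuousOn.comp huc.continuousOn fun x hx => hmem _ hx.1 _ hx.2
  -- Compactness of disc times interval gives a constant that dominates the derivative under the
  -- integral.
  obtain ⟨B, hB⟩ := ((isCompact_closedBall (0 : ℂ) ε).prod isCompact_Icc).exists_bound_of_continuousOn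
    hcont
  have hI : Set.uIoc 0 L ⊆ Set.Icc 0 L := by
    rw [Set.uIoc_of_le hL.le]; exact Set.Ioc_subset_Icc_self
  have hfc : ∀ s ∈ Metric.closedBall (0 : ℂ) ε,
      ContinuousOn (fun X => f (u (s, X))) (Set.Icc 0 L) := fun s hs =>
    hf.continuousOn.comp (huc.comp (by fun_prop : Continuous fun X : ℝ => (s, X))).continuousOn
      fun X hX => hmem s hs X hX
  have h0 : (0 : ℂ) ∈ Metric.closedBall (0 : ℂ) ε := Metric.mem_closedBall_self hε.le
  have hF'0 : ContinuousOn (F' 0) (Set.uIoc 0 L) := by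
    refine continuousOn_finsetSum _ fun β _ => ContinuousOn.mul ?_ (by fun_prop)
    exact (hf.pd β).continuousOn.comp
      (huc.comp (by fun_prop : Continuous fun X : ℝ => ((0 : ℂ), X))).continuousOn
      fun X hX => hmem 0 h0 X (hI hX)
  have key := intervalIntegral.hasDerivAt_integral_of_dominated_loc_of_deriv_le
    (μ := volume) (a := 0) (b := L) (F := fun s X => f (u (s, X))) (F' := F') (x₀ := 0)
    (s := Metric.closedBall (0 : ℂ) ε) (bound := fun _ => B)
    (Metric.closedBall_mem_nhds _ hε) ?_ ?_ ?_ ?_ ?_ ?_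
  · refine key.2.congr_deriv ?_
    simp [hF', hu]
  · filter_upwards [Metric.closedBall_mem_nhds (0 : ℂ) hε] with s hs
    exact ((hfc s hs).mono hI).aestronglyMeasurable measurableSet_uIoc
  · exact ContinuousOn.intervalIntegrable (by rw [Set.uIcc_of_le hL.le]; exact hfc 0 h0)
  · refine ContinuousOn.aestronglyMeasurable ?_ measurableSet_uIoc
    exact hF'0
  · exact ae_of_all _ fun X hX s hs => hB (s, X) ⟨hs, hI hX⟩
  · exact intervalIntegrable_const
  · refine ae_of_all _ fun X hX s hs => ?_
    have h1 : HasDerivAt (fun s : ℂ => u (s, X)) (w X) s := by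
      simpa [hu] using ((hasDerivAt_id s).smul_const (w X)).const_add (v X)
    have h2 := (hf _ (hmem s hs X (hI hX))).differentiableAt.hasFDerivAt.comp_hasDerivAt s h1
    exact h2.congr_deriv (fderiv_apply_eq_sum_pd _ _ _)

theorem HasVarDeriv.const_mul {L : ℝ} {H : (ℝ → Fin n → ℂ) → ℂ} {v δ : ℝ → Fin n → ℂ}
    (h : HasVarDeriv L H v δ) (c : ℂ) :
    HasVarDeriv L (fun u => c * H u) v fun X β => c * δ X β := by
  refine ⟨⟨contDiff_pi.2 fun β => contDiff_const.mul (contDiff_pi.1 h.1.1 β), fun X => ?_⟩,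
    fun w hw => ((h.2 w hw).const_mul c).congr_deriv ?_⟩
  · funext β
    simp only [h.1.2 X]
  · rw [← intervalIntegral.integral_const_mul]
    simp only [Finset.mul_sum, mul_assoc]

theorem HasVarDeriv.sum {ι : Type*} {L : ℝ} {s : Finset ι} {H : ι → (ℝ → Fin n → ℂ) → ℂ}
    {v : ℝ → Fin n → ℂ} {δ : ι → ℝ → Fin n → ℂ} (h : ∀ i ∈ s, HasVarDeriv L (H i) v (δ i)) :
    HasVarDeriv L (fun u => ∑ i ∈ s, H i u) v fun X β => ∑ i ∈ s, δ i X β := by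
  refine ⟨⟨contDiff_pi.2 fun β => ContDiff.sum fun i hi => contDiff_pi.1 (h i hi).1.1 β,
    fun X => ?_⟩, fun w hw => ?_⟩
  · funext β
    exact Finset.sum_congr rfl fun i hi => by rw [(h i hi).1.2 X]
  · refine (HasDerivAt.fun_sum fun i hi => (h i hi).2 w hw).congr_deriv ?_
    rw [← intervalIntegral.integral_finsetSum]
    · refine intervalIntegral.integral_congr fun X _ => ?_
      simp only [Finset.sum_mul]
      exact Finset.sum_comm
    · intro i hi
      refine Continuous.intervalIntegrable ?_ _ _
      exact continuous_finsetSum _ fun β _ =>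
        (contDiff_pi.1 (h i hi).1.1 β).continuous.mul (contDiff_pi.1 hw.1 β).continuous

theorem HasVarDeriv.varDeriv_eq {L : ℝ} (hL : 0 < L) {H : (ℝ → Fin n → ℂ) → ℂ}
    {v δ : ℝ → Fin n → ℂ} (h : HasVarDeriv L H v δ) : varDeriv L H v = δ := by
  have he : ∃ δ, HasVarDeriv L H v δ := ⟨δ, h⟩
  rw [varDeriv, dif_pos he]
  exact he.choose_spec.unique hL h

end
end GenusZero

namespace GenusZero

/-! ### The Frobenius algebra -/

namespace WDVVSolution
variable {n : ℕ} [NeZero n] (M : WDVVSolution n) {t : Fin n → ℂ}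

theorem etaInv_symm (α β : Fin n) : M.η⁻¹ α β = M.η⁻¹ β α := by
  have h : (M.η⁻¹).transpose = M.η⁻¹ := by rw [Matrix.transpose_nonsing_inv, M.eta_symm]
  exact congrFun (congrFun h β) α

theorem cLow_swap_left (ht : t ∈ M.U) (α β γ : Fin n) : M.cLow α β γ t = M.cLow β α γ t :=
  pd_comm (M.analytic_F.pd γ) ht α β

theorem cLow_swap_right (ht : t ∈ M.U) (α β γ : Fin n) : M.cLow α β γ t = M.cLow α γ β t := by
  have : pd β (pd γ M.F) =ᶠ[nhds t] pd γ (pd β M.F) := by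
    filter_upwards [M.isOpen_U.mem_nhds ht] with s hs
    exact pd_comm M.analytic_F hs β γ
  unfold cLow
  conv_lhs => rw [pd]
  rw [this.fderiv_eq]
  rfl

theorem cUp_eq_sum_c (ht : t ∈ M.U) (α β γ : Fin n) :
    M.cUp α β γ t = ∑ a, M.η⁻¹ α a * M.c β γ a t := by
  simp only [cUp, c, Finset.mul_sum, mul_assoc]
  refine Finset.sum_congr rfl fun a _ => Finset.sum_congr rfl fun b _ => ?_
  rw [M.cLow_swap_left ht a b γ, M.cLow_swap_right ht b a γ]

/-- Multiplications by `∂_ε` and `∂_γ` commute: this is WDVV with one index raised, by symmetry of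
`∂∂∂F`. -/
theorem associativity (ht : t ∈ M.U) (a γ ε ρ : Fin n) :
    ∑ β, M.c β ε a t * M.c ρ γ β t = ∑ β, M.c β γ a t * M.c ρ ε β t := by
  have key : ∀ (x y : Fin n), ∑ β, M.c β x a t * M.c ρ y β t =
      ∑ τ, M.η⁻¹ ρ τ * ∑ l, ∑ m, M.cLow x a l t * M.η⁻¹ l m * M.cLow m τ y t := by
    intro x y
    simp only [c, Finset.mul_sum, Finset.sum_mul]
    rw [Finset.sum_comm_cycle, Finset.sum_comm_cycle]
    refine Finset.sum_congr rfl fun τ _ => ?_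
    refine Finset.sum_congr rfl fun l _ => Finset.sum_congr rfl fun m _ => ?_
    rw [M.cLow_swap_left ht l x a, M.cLow_swap_right ht x l a, M.etaInv_symm m l,
      M.cLow_swap_right ht τ y m, M.cLow_swap_left ht τ m y]
    ring
  rw [key, key]
  refine Finset.sum_congr rfl fun τ _ => ?_
  congr 1
  exact M.wdvv t ht ε a τ γ

/-- `c_ε^{αβ} c_{γβ}^ρ = c_γ^{αβ} c_{εβ}^ρ`. -/
theorem associativity_cUp (ht : t ∈ M.U) (α γ ε ρ : Fin n) :
    ∑ β, M.cUp α β ε t * M.c ρ γ β t = ∑ β, M.cUp α β γ t * M.c ρ ε β t := by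
  have key : ∀ x y : Fin n, ∑ β, M.cUp α β x t * M.c ρ y β t =
      ∑ a, M.η⁻¹ α a * ∑ β, M.c β x a t * M.c ρ y β t := by
    intro x y
    simp only [M.cUp_eq_sum_c ht, Finset.sum_mul, Finset.mul_sum]
    rw [Finset.sum_comm]
    exact Finset.sum_congr rfl fun a _ => Finset.sum_congr rfl fun β _ => by ring
  rw [key, key]
  exact Finset.sum_congr rfl fun a _ => by rw [M.associativity ht]

/-- `g^{αβ} c_{γβ}^ρ = c_γ^{αβ} (E ·)^ρ_β`. -/
theorem g_mul_c (ht : t ∈ M.U) (α γ ρ : Fin n) :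
    ∑ β, M.g t α β * M.c ρ γ β t = ∑ β, M.cUp α β γ t * M.eulerMul t ρ β := by
  simp only [g, eulerMul, Matrix.of_apply, Finset.sum_mul, Finset.mul_sum]
  rw [Finset.sum_comm]
  conv_rhs => rw [Finset.sum_comm]
  refine Finset.sum_congr rfl fun ε _ => ?_
  have := congrArg (fun x => M.euler t ε * x) (M.associativity_cUp ht α γ ε ρ)
  simp only [Finset.mul_sum] at this
  refine Eq.trans (Finset.sum_congr rfl fun β _ => by ring) (this.trans ?_)
  exact Finset.sum_congr rfl fun β _ => by ring

end WDVVSolution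

/-! ### The two brackets -/

section
variable {n : ℕ} [NeZero n] {M : WDVVSolution n} {θ : Fin n → ℕ → (Fin n → ℂ) → ℂ}
  {R : Matrix (Fin n) (Fin n) ℂ} {t : Fin n → ℂ}

namespace IsDeformedFlat

/-- `θ_{σ,0}` is linear. This is the bottom of the recursion, where there is no `θ_{σ,-1}`. -/
theorem pd_pd_zero (hθ : IsDeformedFlat M θ R) (ht : t ∈ M.U) (γ β σ : Fin n) :
    pd γ (pd β (θ σ 0)) t = 0 := by
  have h1 : ∀ s ∈ M.U, pd β (θ σ 0) s = M.η σ β := by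
    intro s hs
    have he : θ σ 0 =ᶠ[nhds s] fun u => ∑ ε, M.η σ ε * u ε := by
      filter_upwards [M.isOpen_U.mem_nhds hs] with u hu
      exact hθ.zero σ u hu
    have hd : HasFDerivAt (fun u : Fin n → ℂ => ∑ ε, M.η σ ε * u ε)
        (∑ ε, M.η σ ε • (ContinuousLinearMap.proj ε : (Fin n → ℂ) →L[ℂ] ℂ)) s :=
      HasFDerivAt.fun_sum fun ε _ => (hasFDerivAt_apply ε s).const_mul _
    rw [pd, he.fderiv_eq, hd.fderiv]
    simp [Pi.single_apply]
  have h2 : pd β (θ σ 0) =ᶠ[nhds t] fun _ => M.η σ β := by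
    filter_upwards [M.isOpen_U.mem_nhds ht] with s hs using h1 s hs
  rw [pd, h2.fderiv_eq]
  simp

/-- The density of the first bracket with the Hamiltonian `∫ θ_{σ,l+1}`. -/
theorem etaInv_mul_hessian (hθ : IsDeformedFlat M θ R) (ht : t ∈ M.U) (α γ σ : Fin n) (l : ℕ) :
    ∑ β, M.η⁻¹ α β * pd γ (pd β (θ σ (l + 1))) t = ∑ ρ, M.cUp α ρ γ t * pd ρ (θ σ l) t := by
  simp only [hθ.recursion t ht, Finset.mul_sum]
  rw [Finset.sum_comm]
  refine Finset.sum_congr rfl fun ρ _ => ?_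
  rw [M.cUp_eq_sum_c ht, Finset.sum_mul]
  exact Finset.sum_congr rfl fun β _ => by ring

/-- For `l ≥ 1` flatness expresses the Hessian through `dθ_{σ,l-1}`, and associativity moves `E`
from the intersection form onto that differential. For `l = 0` both sides vanish. -/
theorem g_mul_hessian (hθ : IsDeformedFlat M θ R) (ht : t ∈ M.U) (α γ σ : Fin n) (l : ℕ) :
    ∑ β, M.g t α β * pd γ (pd β (θ σ l)) t =
      ∑ β, M.cUp α β γ t *
        (if 1 ≤ l then ∑ ρ, M.eulerMul t ρ β * pd ρ (θ σ (l - 1)) t else 0) := by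
  cases l with
  | zero => simp [hθ.pd_pd_zero ht]
  | succ l =>
    simp only [hθ.recursion t ht, Finset.mul_sum, le_add_iff_nonneg_left, zero_le, if_true,
      Nat.add_sub_cancel]
    rw [Finset.sum_comm]
    conv_rhs => rw [Finset.sum_comm]
    refine Finset.sum_congr rfl fun ρ _ => ?_
    have := congrArg (fun x => x * pd ρ (θ σ l) t) (M.g_mul_c ht α γ ρ)
    simp only [Finset.sum_mul] at this
    refine Eq.trans (Finset.sum_congr rfl fun β _ => by ring) (this.trans ?_)
    exact Finset.sum_congr rfl fun β _ => by ring

/-- The bihamiltonian recursion, before contraction with `v_X`. -/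
theorem density_recursion (hθ : IsDeformedFlat M θ R) (ht : t ∈ M.U) (α γ σ : Fin n) (l : ℕ) :
    ∑ β, M.g t α β * pd γ (pd β (θ σ l)) t + ∑ β, M.Gam α β γ t * pd β (θ σ l) t =
      ((l : ℂ) + 1 / 2 + M.mu σ) * ∑ β, M.cUp α β γ t * pd β (θ σ l) t +
      ∑ k ∈ Finset.Icc 1 l, ∑ τ,
        (∑ β, M.cUp α β γ t * pd β (θ τ (l - k)) t) * M.comp R k τ σ := by
  rw [hθ.g_mul_hessian ht]
  simp only [← hθ.coeff_recursion ht l]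
  have e : ∑ k ∈ Finset.Icc 1 l, ∑ τ,
      (∑ β, M.cUp α β γ t * pd β (θ τ (l - k)) t) * M.comp R k τ σ =
      ∑ β, M.cUp α β γ t *
        ∑ k ∈ Finset.Icc 1 l, ∑ τ, pd β (θ τ (l - k)) t * M.comp R k τ σ := by
    simp only [Finset.mul_sum, Finset.sum_mul]
    rw [Finset.sum_comm_cycle]
    simp only [mul_assoc]
  rw [e, ← Finset.sum_add_distrib, Finset.mul_sum, ← Finset.sum_add_distrib]
  refine Finset.sum_congr rfl fun β _ => ?_
  -- Here `(1 + d)/2 - q_β = 1/2 - μ_β`, so `μ_β` cancels against the coefficient `l + μ_β + μ_σ`.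
  simp only [WDVVSolution.Gam, WDVVSolution.mu]
  ring

end IsDeformedFlat

/-- `{v^α(X), H_{σ,l}}_1` as a differential polynomial in `v`. -/
def flow (M : WDVVSolution n) (θ : Fin n → ℕ → (Fin n → ℂ) → ℂ) (v : ℝ → Fin n → ℂ) (X : ℝ)
    (α : Fin n) (l : ℕ) (σ : Fin n) : ℂ :=
  ∑ γ, (∑ β, M.cUp α β γ (v X) * pd β (θ σ l) (v X)) * deriv (fun Y => v Y γ) X

variable {L : ℝ} {v : ℝ → Fin n → ℂ}

/-- The density of `H_{σ,l}` is `θ_{σ,l+1}`; one use of flatness lowers the level back to `l`. -/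
theorem IsDeformedFlat.bracket₁_ham (hθ : IsDeformedFlat M θ R) (hL : 0 < L)
    (hv : IsSmoothLoop L v) (hvU : ∀ X, v X ∈ M.U) (σ : Fin n) (l : ℕ) (X : ℝ) (α : Fin n) :
    bracket₁ M L (ham L θ σ l) v X α = flow M θ v X α l σ := by
  have hvar := (hasVarDeriv_integral hL M.isOpen_U (hθ.analytic σ (l + 1)) hv hvU).varDeriv_eq hL
  have hvd : DifferentiableAt ℝ v X := hv.1.differentiable (by simp) X
  have hH : varDeriv L (ham L θ σ l) v = fun X β => pd β (θ σ (l + 1)) (v X) := hvar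
  have hder : ∀ β, deriv (fun Y => pd β (θ σ (l + 1)) (v Y)) X =
      ∑ γ, pd γ (pd β (θ σ (l + 1))) (v X) * deriv (fun Y => v Y γ) X := fun β =>
    (hasDerivAt_comp_loop (((hθ.analytic σ (l + 1)).pd β) _ (hvU X)) hvd).deriv
  simp only [bracket₁, hydroBracket, hH, hder, zero_mul, Finset.sum_const_zero, add_zero]
  simp only [flow, ← hθ.etaInv_mul_hessian (hvU X), Finset.mul_sum, Finset.sum_mul]
  rw [Finset.sum_comm]
  exact Finset.sum_congr rfl fun γ _ => Finset.sum_congr rfl fun β _ => by ring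

/-- The coefficient of `δH/δv^β = ∂_β f` and its derivative in the second bracket. -/
theorem IsDeformedFlat.second_bracket_density (hθ : IsDeformedFlat M θ R)
    (hv : IsSmoothLoop L v) (hvU : ∀ X, v X ∈ M.U) (σ : Fin n) (l : ℕ) (X : ℝ) (α : Fin n) :
    ∑ β, M.g (v X) α β * deriv (fun Y => pd β (θ σ l) (v Y)) X +
      ∑ β, (∑ γ, M.Gam α β γ (v X) * deriv (fun Y => v Y γ) X) * pd β (θ σ l) (v X) =
    ((l : ℂ) + 1 / 2 + M.mu σ) * flow M θ v X α l σ +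
      ∑ k ∈ Finset.Icc 1 l, ∑ τ, flow M θ v X α (l - k) τ * M.comp R k τ σ := by
  have hvd : DifferentiableAt ℝ v X := hv.1.differentiable (by simp) X
  have hder : ∀ β, deriv (fun Y => pd β (θ σ l) (v Y)) X =
      ∑ γ, pd γ (pd β (θ σ l)) (v X) * deriv (fun Y => v Y γ) X := fun β =>
    (hasDerivAt_comp_loop (((hθ.analytic σ l).pd β) _ (hvU X)) hvd).deriv
  have e1 : ∑ β, M.g (v X) α β * deriv (fun Y => pd β (θ σ l) (v Y)) X +
      ∑ β, (∑ γ, M.Gam α β γ (v X) * deriv (fun Y => v Y γ) X) * pd β (θ σ l) (v X) =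
      ∑ γ, (∑ β, M.g (v X) α β * pd γ (pd β (θ σ l)) (v X) +
        ∑ β, M.Gam α β γ (v X) * pd β (θ σ l) (v X)) * deriv (fun Y => v Y γ) X := by
    simp only [hder, add_mul, Finset.sum_add_distrib, Finset.mul_sum, Finset.sum_mul]
    congr 1 <;>
    · rw [Finset.sum_comm]
      exact Finset.sum_congr rfl fun γ _ => Finset.sum_congr rfl fun β _ => by ring
  have e2 : ∑ k ∈ Finset.Icc 1 l, ∑ τ, flow M θ v X α (l - k) τ * M.comp R k τ σ =
      ∑ γ, (∑ k ∈ Finset.Icc 1 l, ∑ τ,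
        (∑ β, M.cUp α β γ (v X) * pd β (θ τ (l - k)) (v X)) * M.comp R k τ σ) *
          deriv (fun Y => v Y γ) X := by
    simp only [flow, Finset.sum_mul]
    rw [Finset.sum_comm_cycle]
    exact Finset.sum_congr rfl fun γ _ => Finset.sum_congr rfl fun k _ =>
      Finset.sum_congr rfl fun τ _ => Finset.sum_congr rfl fun β _ => by ring
  rw [e1, e2, flow, Finset.mul_sum, ← Finset.sum_add_distrib]
  refine Finset.sum_congr rfl fun γ _ => ?_
  rw [hθ.density_recursion (hvU X)]
  ring

theorem IsDeformedFlat.hasVarDeriv_hamHat (hθ : IsDeformedFlat M θ R) (hL : 0 < L)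
    (hv : IsSmoothLoop L v) (hvU : ∀ X, v X ∈ M.U) (α : Fin n) (p : ℕ) :
    HasVarDeriv L (hamHat M L θ R α p) v fun X β =>
      ∑ k ∈ Finset.range (p + 1), ∑ l ∈ Finset.range (p + 1), ∑ ε,
        (-1) ^ k * M.compProd R (p - l) k ε α / ((p : ℂ) + M.mu α + 1 / 2) ^ (k + 1) *
          pd β (θ ε l) (v X) := by
  have h : hamHat M L θ R α p = fun u =>
      ∑ k ∈ Finset.range (p + 1), ∑ l ∈ Finset.range (p + 1), ∑ ε,
        (-1) ^ k * M.compProd R (p - l) k ε α / ((p : ℂ) + M.mu α + 1 / 2) ^ (k + 1) *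
          ∫ X in (0 : ℝ)..L, θ ε l (u X) := by
    funext u
    simp only [hamHat, hamPred, mul_div_right_comm]
  rw [h]
  exact HasVarDeriv.sum fun k _ => HasVarDeriv.sum fun l _ => HasVarDeriv.sum fun ε _ =>
    (hasVarDeriv_integral hL M.isOpen_U (hθ.analytic ε l) hv hvU).const_mul _

theorem IsDeformedFlat.bracket₂_hamHat (hθ : IsDeformedFlat M θ R) (hL : 0 < L)
    (hv : IsSmoothLoop L v) (hvU : ∀ X, v X ∈ M.U) (α : Fin n) (p : ℕ)
    (hp : (p : ℂ) + M.mu α + 1 / 2 ≠ 0) (X : ℝ) (β : Fin n) :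
    bracket₂ M L (hamHat M L θ R α p) v X β = flow M θ v X β p α := by
  have hvd : DifferentiableAt ℝ v X := hv.1.differentiable (by simp) X
  have hd : ∀ ε l γ, DifferentiableAt ℝ (fun Y => pd γ (θ ε l) (v Y)) X := fun ε l γ =>
    (hasDerivAt_comp_loop (((hθ.analytic ε l).pd γ) _ (hvU X)) hvd).differentiableAt
  -- Rewrites the flow as the weighted sum of the second brackets with `H_{ε,l-1}`, the sequence `b`
  -- being read off from `second_bracket_density`. What remains is linearity of the second bracket.
  rw [← M.sum_compProd_of_recursion R (fun l σ => flow M θ v X β l σ) _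
    (fun l σ => hθ.second_bracket_density hv hvU σ l X β) α p hp]
  have hder : ∀ (c : ℕ → ℕ → Fin n → ℂ) (γ : Fin n),
      deriv (fun Y => ∑ k ∈ Finset.range (p + 1), ∑ l ∈ Finset.range (p + 1), ∑ ε,
        c k l ε * pd γ (θ ε l) (v Y)) X =
      ∑ k ∈ Finset.range (p + 1), ∑ l ∈ Finset.range (p + 1), ∑ ε,
        c k l ε * deriv (fun Y => pd γ (θ ε l) (v Y)) X := by
    intro c γ
    exact (HasDerivAt.fun_sum fun k _ => HasDerivAt.fun_sum fun l _ => HasDerivAt.fun_sum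
      fun ε _ => (hd ε l γ).hasDerivAt.const_mul _).deriv
  rw [bracket₂, hydroBracket, (hθ.hasVarDeriv_hamHat hL hv hvU α p).varDeriv_eq hL]
  have hlin : ∀ (c : ℕ → ℕ → Fin n → ℂ) (a : Fin n → ℂ) (x : ℕ → ℕ → Fin n → Fin n → ℂ),
      ∑ γ, a γ * ∑ k ∈ Finset.range (p + 1), ∑ l ∈ Finset.range (p + 1), ∑ ε,
        c k l ε * x k l ε γ =
      ∑ k ∈ Finset.range (p + 1), ∑ l ∈ Finset.range (p + 1), ∑ ε,
        c k l ε * ∑ γ, a γ * x k l ε γ := by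
    intro c a x
    simp only [Finset.mul_sum]
    rw [Finset.sum_comm]
    refine Finset.sum_congr rfl fun k _ => ?_
    rw [Finset.sum_comm]
    refine Finset.sum_congr rfl fun l _ => ?_
    rw [Finset.sum_comm]
    exact Finset.sum_congr rfl fun ε _ => Finset.sum_congr rfl fun γ _ => by ring
  simp only [hder, hlin, ← Finset.sum_add_distrib, ← mul_add]
  refine Finset.sum_congr rfl fun k _ => Finset.sum_congr rfl fun l _ =>
    Finset.sum_congr rfl fun ε _ => ?_
  simp only [Finset.sum_add_distrib]
  ring

end
end GenusZero

end

theorem proposition2 {n : ℕ} [NeZero n] (M : GenusZero.WDVVSolution n)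
    (θ : Fin n → ℕ → (Fin n → ℂ) → ℂ) (R : Matrix (Fin n) (Fin n) ℂ)
    (hθ : GenusZero.IsDeformedFlat M θ R)
    (L : ℝ) (hL : 0 < L) (α : Fin n) (p : ℕ)
    (hp : (p : ℂ) + M.mu α + 1 / 2 ≠ 0)
    (v : ℝ → Fin n → ℂ) (hv : GenusZero.IsSmoothLoop L v) (hvU : ∀ X, v X ∈ M.U) :
    (∃ δ, GenusZero.HasVarDeriv L (GenusZero.ham L θ α p) v δ) ∧
    (∃ δ, GenusZero.HasVarDeriv L (GenusZero.hamHat M L θ R α p) v δ) ∧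
    ∀ (X : ℝ) (β : Fin n),
      GenusZero.bracket₁ M L (GenusZero.ham L θ α p) v X β =
        GenusZero.bracket₂ M L (GenusZero.hamHat M L θ R α p) v X β :=
  ⟨⟨_, GenusZero.hasVarDeriv_integral hL M.isOpen_U (hθ.analytic α (p + 1)) hv hvU⟩,
    ⟨_, hθ.hasVarDeriv_hamHat hL hv hvU α p⟩, fun X β =>
    (hθ.bracket₁_ham hL hv hvU α p X β).trans (hθ.bracket₂_hamHat hL hv hvU α p hp X β).symm⟩
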